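/- Let $(R,\mathfrak m,k)$ be a commutative Noetherian local ring and let $M\neq 0$ be an $R$-module. For a complex $I=(\cdots\to I_{i+1}\to I_i\to I_{i-1}\to\cdots)$ of $R$-modules put $\inf I=\inf\{i: I_i\neq 0\}$ and $\operatorname{hinf} I=\inf\{i: H_i(I)\neq 0\}$. A bounded quasi-injective resolution of $M$ is a bounded complex $I$ of injective $R$-modules such that there are non-negative integers $b_i$, not all zero, with $H_i(I)\cong M^{\oplus b_i}$ for all $i$. The quasi-injective dimension $\operatorname{qid}_R M$ of $M \neq 0$ is the infimum of $\operatorname{hinf} I-\inf I$ over all bounded quasi-injective resolutions $I$ of $M$ ($\infty$ if there is none). The module $M$ is called $\operatorname{Ext}$-finite if $\operatorname{Ext}^i_R(N,M)$ is a finitely generated $R$-module for every finitely generated $R$-module $N$ and every $i\geq 1$. A maximal $R$-sequence in $\mathfrak m$ is a (possibly empty) $R$-regular sequence $\boldsymbol x=x_1,\dots,x_r$ of elements of $\mathfrak m$ such that $x_1,\dots,x_r,y$ is not an $R$-regular sequence for any $y\in\mathfrak m$. Assume that $M\neq0$ is $\operatorname{Ext}$-finite and $\operatorname{qid}_R M<\infty$,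 and let $n\geq 0$ be an integer. The following conditions are equivalent: 1. $\operatorname{qid}_R M\leq n$. 2. $\operatorname{Ext}^i_R(N,M)=0$ for all $i>n$ and all $R$-modules $N$ such that $\operatorname{Ext}^i_R(N,M)=0$ for $i\gg0$. 3. $\operatorname{Ext}^i_R(R/J,M)=0$ for all $i>n$ and all ideals $J$ of $R$ such that $\operatorname{Ext}^i_R(R/J,M)=0$ for $i\gg0$. 4. $\operatorname{Ext}^i_R(R/(\boldsymbol x),M)=0$ for all $i>n$ and every maximal $R$-sequence $\boldsymbol x$ in $\mathfrak m$. 5. $\operatorname{Ext}^i_R(R/(\boldsymbol x),M)=0$ for all $i>n$ and some maximal $R$-sequence $\boldsymbol x$ in $\mathfrak m$. -/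

import Mathlib

open CategoryTheory CategoryTheory.Limits IsLocalRing

universe u

section QuasiInjective

variable (R : Type u) [CommRing R]

/-- `Ext_R^i(N, M)`, as an `R`-module. -/
noncomputable abbrev ExtMod (N M : Type u) [AddCommGroup N] [Module R N]
    [AddCommGroup M] [Module R M] (i : ℕ) : Type u :=
  Abelian.Ext (ModuleCat.of R N) (ModuleCat.of R M) i

/-- `M` is `Ext`-finite: `Ext_R^i(N, M)` is a finitely generated `R`-module for every finitely
generated `R`-module `N` and every `i ≥ 1`. -/
def ExtFinite (M : Type u) [AddCommGroup M] [Module R M] : Prop :=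
  ∀ (N : Type u) [AddCommGroup N] [Module R N], Module.Finite R N →
    ∀ i : ℕ, 1 ≤ i → Module.Finite R (ExtMod R N M i)

/-- `Ext_R^i(N, M) = 0` for all `i > n`. -/
def ExtVanishesAbove (N M : Type u) [AddCommGroup N] [Module R N]
    [AddCommGroup M] [Module R M] (n : ℕ) : Prop :=
  ∀ i : ℕ, n < i → Subsingleton (ExtMod R N M i)

/-- `Ext_R^i(N, M) = 0` for all `i ≫ 0`. -/
def ExtVanishesEventually (N M : Type u) [AddCommGroup N] [Module R N]
    [AddCommGroup M] [Module R M] : Prop :=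
  ∃ m : ℕ, ExtVanishesAbove R N M m

variable {R}

/-- A bounded above complex `⋯ → I_{i+1} → I_i → I_{i-1} → ⋯` of injective `R`-modules is a
quasi-injective resolution of `M` if there are non-negative integers `b_i`, not all zero, such that
`H_i(I) ≅ M^{⊕ b_i}`. (Above the supremum of `I` the homology vanishes; for `M ≠ 0` the
condition there just says `b_i = 0`.) -/
structure IsQuasiInjectiveResolution (M : Type u) [AddCommGroup M] [Module R M]
    (I : ChainComplex (ModuleCat.{u} R) ℤ) : Prop where
  injective : ∀ i, Injective (I.X i)
  boundedAbove : ∃ a : ℤ, ∀ i, a < i → IsZero (I.X i)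
  homology : ∃ b : ℤ → ℕ, (∃ i, b i ≠ 0) ∧
    ∀ i, Nonempty (I.homology i ≅ ModuleCat.of R (Fin (b i) → M))

/-- A quasi-injective resolution that is also bounded below. -/
structure IsBoundedQuasiInjectiveResolution (M : Type u) [AddCommGroup M] [Module R M]
    (I : ChainComplex (ModuleCat.{u} R) ℤ) : Prop extends IsQuasiInjectiveResolution M I where
  boundedBelow : ∃ a : ℤ, ∀ i, i < a → IsZero (I.X i)

/-- `s = hinf I = inf {i : H_i(I) ≠ 0}`, the infimum being finite (hence attained). -/
def IsHinf (I : ChainComplex (ModuleCat.{u} R) ℤ) (s : ℤ) : Prop :=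
  IsLeast {i : ℤ | ¬ IsZero (I.homology i)} s

/-- `t = inf I = inf {i : I_i ≠ 0}`, the infimum being finite (hence attained). -/
def IsInf (I : ChainComplex (ModuleCat.{u} R) ℤ) (t : ℤ) : Prop :=
  IsLeast {i : ℤ | ¬ IsZero (I.X i)} t

variable (R)

open Classical in
/-- The quasi-injective dimension: `-∞` for the zero module, and otherwise the infimum of
`hinf I - inf I` over all bounded quasi-injective resolutions `I` of `M` (so `∞` if there is none).
For `M ≠ 0` both `hinf I` and `inf I` are finite for each such `I`, and
`hinf I - inf I ≥ 0`, so it is a natural number `d`. -/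
noncomputable def qid (M : Type u) [AddCommGroup M] [Module R M] : WithBot ℕ∞ :=
  if Subsingleton M then ⊥
  else sInf {q : WithBot ℕ∞ | ∃ (I : ChainComplex (ModuleCat.{u} R) ℤ) (s t : ℤ) (d : ℕ),
    IsBoundedQuasiInjectiveResolution M I ∧ IsHinf I s ∧ IsInf I t ∧
      s - t = (d : ℤ) ∧ q = ((d : ℕ∞) : WithBot ℕ∞)}

end QuasiInjective

/-- `x_1, …, x_r` is a maximal `R`-sequence in the maximal ideal of the local ring `R`: it is an
`R`-sequence of elements of `𝔪` that cannot be prolonged by an element of `𝔪`. The empty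
sequence is allowed. -/
def IsMaximalRSequence {R : Type u} [CommRing R] [IsLocalRing R] (x : List R) : Prop :=
  (∀ a ∈ x, a ∈ maximalIdeal R) ∧ RingTheory.Sequence.IsRegular R x ∧
    ∀ y ∈ maximalIdeal R, ¬ RingTheory.Sequence.IsRegular R (x ++ [y])

/-! Write Z and B for the cycles and boundaries of a bounded quasi-injective resolution `I`, and let
s = hinf `I`. The sequences 0 → Z_{i+1} → I_{i+1} → B_i → 0 and 0 → B_i → Z_i → H_i → 0, with H_i a
power of `M`, carry properties of high Ext into `M` over to every Z_i, by descending induction from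
the top of `I`.

1 → 2: if `I` has length at most n below s, exactness there gives Z_s injective dimension at most n.
The sequence 0 → B_s → Z_s → H_s → 0 then lowers any vanishing bound for Ext(N, M) one degree at a
time until it reaches n (`extVanishesAbove`).

5 → 1: dimension shifting turns the vanishing for R/(x) into Ext^j(R/(x), Z_{s-n}) = 0 for all j ≥
1. As x is maximal, the residue field embeds in R/(x). Moreover Z_{s-n} has finite injective
dimension and finitely generated Ext, so it is injective by a Bass-type argument
(`ModuleCat.injective_of_subsingleton_ext`). Truncating `I` at s - n yields a resolution of length
at most n below s. -/

/-! ### Properties closed under exact sequences, so that vanishing and finite generation share one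
Ext chase. -/

section ExactClosed

variable {R : Type u} [CommRing R]

/-- A property of modules that holds for the zero module and for the middle term of an exact
sequence as soon as it holds for the outer terms. -/
structure IsExactClosed (P : ∀ (A : Type u) [AddCommGroup A] [Module R A], Prop) : Prop where
  of_subsingleton : ∀ (A : Type u) [AddCommGroup A] [Module R A], Subsingleton A → P A
  of_exact : ∀ {A B C : Type u} [AddCommGroup A] [Module R A] [AddCommGroup B] [Module R B]
    [AddCommGroup C] [Module R C] (f : A →ₗ[R] B) (g : B →ₗ[R] C),
    (∀ b, g b = 0 → ∃ a, f a = b) → P A → P C → P B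

theorem isExactClosed_subsingleton :
    IsExactClosed (R := R) (fun A _ _ => Subsingleton A) where
  of_subsingleton _ _ _ h := h
  of_exact f g h hA hC := by
    refine subsingleton_of_forall_eq 0 fun b => ?_
    obtain ⟨a, rfl⟩ := h b (Subsingleton.elim _ _)
    rw [Subsingleton.elim a 0, map_zero]

theorem isExactClosed_finite [IsNoetherianRing R] :
    IsExactClosed (R := R) (fun A _ _ => Module.Finite R A) where
  of_subsingleton _ _ _ _ := inferInstance
  of_exact {A B C} _ _ _ _ _ _ f g h hA hC := by
    have hle : LinearMap.ker g ≤ LinearMap.range f := fun b hb => h b hb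
    have : IsNoetherian R A := isNoetherian_of_isNoetherianRing_of_finite R A
    have : IsNoetherian R C := isNoetherian_of_isNoetherianRing_of_finite R C
    have h1 : (LinearMap.ker g).FG :=
      isNoetherian_submodule.mp
        (isNoetherian_of_surjective f.rangeRestrict f.range_rangeRestrict) _ hle
    have h2 : (Submodule.map g ⊤).FG := IsNoetherian.noetherian _
    exact ⟨Submodule.fg_of_fg_map_of_fg_inf_ker g h2 (by simpa using h1)⟩

namespace IsExactClosed

open Abelian

variable {P : ∀ (A : Type u) [AddCommGroup A] [Module R A], Prop} (hP : IsExactClosed P)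
  {S : ShortComplex (ModuleCat.{u} R)} (hS : S.ShortExact) (X : ModuleCat.{u} R)

include hP hS

theorem ext_X₂ {n : ℕ} (h1 : P (Ext X S.X₁ n)) (h3 : P (Ext X S.X₃ n)) : P (Ext X S.X₂ n) :=
  hP.of_exact ((Ext.mk₀ S.f).postcompOfLinear R X (add_zero n))
    ((Ext.mk₀ S.g).postcompOfLinear R X (add_zero n))
    (fun b hb => Ext.covariant_sequence_exact₂ X hS b hb) h1 h3

theorem ext_X₃ {n : ℕ} (h2 : P (Ext X S.X₂ n)) (h1 : P (Ext X S.X₁ (n + 1))) :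
    P (Ext X S.X₃ n) :=
  hP.of_exact ((Ext.mk₀ S.g).postcompOfLinear R X (add_zero n))
    (hS.extClass.postcompOfLinear R X rfl)
    (fun b hb => Ext.covariant_sequence_exact₃ X hS b rfl hb) h2 h1

theorem ext_X₁ {n : ℕ} (h3 : P (Ext X S.X₃ n)) (h2 : P (Ext X S.X₂ (n + 1))) :
    P (Ext X S.X₁ (n + 1)) :=
  hP.of_exact (hS.extClass.postcompOfLinear R X rfl)
    ((Ext.mk₀ S.f).postcompOfLinear R X (add_zero (n + 1)))
    (fun b hb => Ext.covariant_sequence_exact₁ X hS b hb rfl) h3 h2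

theorem contravariant_ext_X₂ {n : ℕ} (h1 : P (Ext S.X₁ X n)) (h3 : P (Ext S.X₃ X n)) :
    P (Ext S.X₂ X n) :=
  hP.of_exact ((Ext.mk₀ S.g).precompOfLinear R X (zero_add n))
    ((Ext.mk₀ S.f).precompOfLinear R X (zero_add n))
    (fun b hb => Ext.contravariant_sequence_exact₂ hS X b hb) h3 h1

theorem contravariant_ext_X₁ {n : ℕ} (h2 : P (Ext S.X₂ X n)) (h3 : P (Ext S.X₃ X (n + 1))) :
    P (Ext S.X₁ X n) :=
  hP.of_exact ((Ext.mk₀ S.f).precompOfLinear R X (zero_add n))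
    (hS.extClass.precompOfLinear R X (add_comm 1 n))
    (fun b hb => Ext.contravariant_sequence_exact₁ hS X b (add_comm 1 n) hb) h2 h3

end IsExactClosed

end ExactClosed

/-! ### A Bass-type criterion for injectivity -/

section Bass

open Abelian

variable {R : Type u} [CommRing R]

theorem LinearMap.shortExact_moduleCatMk {A B C : Type u} [AddCommGroup A] [Module R A]
    [AddCommGroup B] [Module R B] [AddCommGroup C] [Module R C]
    (f : A →ₗ[R] B) (g : B →ₗ[R] C) (hf : Function.Injective f) (hg : Function.Surjective g)
    (h : Function.Exact f g) :
    (ShortComplex.moduleCatMk f g h.linearMap_comp_eq_zero).ShortExact where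
  exact := (ShortComplex.moduleCat_exact_iff _).mpr fun x hx => (h x).mp hx
  mono_f := (ModuleCat.mono_iff_injective _).mpr hf
  epi_g := (ModuleCat.epi_iff_surjective _).mpr hg

theorem subsingleton_ext_congr_left {N N' : Type u} [AddCommGroup N] [Module R N]
    [AddCommGroup N'] [Module R N'] (e : N ≃ₗ[R] N') (X : ModuleCat.{u} R) (j : ℕ)
    (h : Subsingleton (Ext (ModuleCat.of R N') X j)) :
    Subsingleton (Ext (ModuleCat.of R N) X j) := by
  refine subsingleton_of_forall_eq 0 fun x => ?_
  have : x = (Ext.mk₀ e.toModuleIso.hom).comp ((Ext.mk₀ e.toModuleIso.inv).comp x (zero_add j))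
      (zero_add j) := by
    rw [Ext.mk₀_comp_mk₀_assoc, Iso.hom_inv_id, Ext.mk₀_id_comp]
  rw [this, Subsingleton.elim ((Ext.mk₀ e.toModuleIso.inv).comp x (zero_add j)) 0, Ext.comp_zero]

/-- Baer's criterion in terms of `Ext`. -/
theorem ModuleCat.injective_of_subsingleton_ext_one (X : ModuleCat.{u} R)
    (h : ∀ J : Ideal R, Subsingleton (Ext (ModuleCat.of R (R ⧸ J)) X 1)) : Injective X := by
  have hB : Module.Baer R X := by
    intro J g
    have hS := LinearMap.shortExact_moduleCatMk J.subtype J.mkQ J.subtype_injective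
      J.mkQ_surjective (LinearMap.exact_subtype_mkQ J)
    have := h J
    obtain ⟨y, hy⟩ := Ext.contravariant_sequence_exact₁ hS X (Ext.mk₀ (ModuleCat.ofHom g))
      (n₁ := 1) rfl (Subsingleton.elim (α := Ext (ModuleCat.of R (R ⧸ J)) X 1) _ _)
    obtain ⟨φ, rfl⟩ := (Ext.mk₀_bijective _ _).2 y
    rw [Ext.mk₀_comp_mk₀] at hy
    have hφ := (Ext.mk₀_bijective _ _).1 hy
    refine ⟨φ.hom, fun x hx => ?_⟩
    exact congrArg (fun k => k.hom ⟨x, hx⟩) hφ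
  exact Module.injective_object_of_injective_module (inj := hB.injective)

/-- If `y ∈ 𝔪` is regular on `N` and `Ext^{j+1}(N/yN, X) = 0`, then a finitely generated
`Ext^j(N, X)` vanishes, by Nakayama's lemma. -/
theorem subsingleton_ext_of_isSMulRegular [IsLocalRing R] {N X : ModuleCat.{u} R} {y : R}
    (hy : y ∈ maximalIdeal R) (hreg : IsSMulRegular N y) (j : ℕ)
    (hfin : Module.Finite R (Ext N X j))
    (hvan : Subsingleton (Ext (ModuleCat.of R (QuotSMulTop y N)) X (j + 1))) :
    Subsingleton (Ext N X j) := by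
  have hS := hreg.smulShortComplex_shortExact
  have htop : (⊤ : Submodule R (Ext N X j)) ≤ maximalIdeal R • ⊤ := by
    intro a _
    obtain ⟨(b : Ext N X j), hb⟩ := Ext.contravariant_sequence_exact₁ hS X a (add_comm 1 j)
      (Subsingleton.elim (α := Ext (ModuleCat.of R (QuotSMulTop y N)) X (j + 1)) _ _)
    change (Ext.mk₀ (y • 𝟙 N)).comp (Y := N) (X := N) b _ = a at hb
    rw [Ext.mk₀_smul, Ext.smul_comp, Ext.mk₀_id_comp] at hb
    exact hb ▸ Submodule.smul_mem_smul hy trivial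
  exact (Submodule.subsingleton_iff R).mp (subsingleton_of_bot_eq_top
    (Submodule.eq_bot_of_le_smul_of_le_jacobson_bot (maximalIdeal R) ⊤ hfin.fg_top htop
      (IsLocalRing.jacobson_eq_maximalIdeal ⊥ bot_ne_top).ge).symm)

/-- Over a Noetherian local ring, a module of finite injective dimension with finitely generated
`Ext` is injective as soon as its higher `Ext` from a module of depth zero vanishes. -/
theorem ModuleCat.injective_of_subsingleton_ext [IsLocalRing R] [IsNoetherianRing R]
    (X : ModuleCat.{u} R) (e : ℕ) [hX : HasInjectiveDimensionLT X e]
    (hfin : ∀ (N : Type u) [AddCommGroup N] [Module R N], Module.Finite R N →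
      ∀ j, 1 ≤ j → Module.Finite R (Ext (ModuleCat.of R N) X j))
    (L : Type u) [AddCommGroup L] [Module R L] [Module.Finite R L]
    (hL : ∀ j, 1 ≤ j → Subsingleton (Ext (ModuleCat.of R L) X j))
    (ι : (R ⧸ maximalIdeal R) →ₗ[R] L) (hι : Function.Injective ι) : Injective X := by
  -- Descending induction on the Ext degree: stage k covers the degrees above e - k, and k = e
  -- reaches degree 1, where Baer's criterion applies.
  suffices H : ∀ k, k ≤ e → ∀ (N : Type u) [AddCommGroup N] [Module R N], Module.Finite R N →
      ∀ j, e - k < j → Subsingleton (Ext (ModuleCat.of R N) X j) from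
    ModuleCat.injective_of_subsingleton_ext_one X fun J =>
      H e le_rfl (R ⧸ J) inferInstance 1 (by simp)
  intro k
  induction k with
  | zero =>
    intro _ N _ _ _ j hj
    exact HasInjectiveDimensionLT.subsingleton X e j (by lia) _
  | succ k ih =>
    intro hk N _ _ hN j hj
    rcases (show e - k < j ∨ j = e - k by lia) with hj' | rfl
    · exact ih (by lia) N hN j hj'
    have ih' := fun N [AddCommGroup N] [Module R N] (hN : Module.Finite R N) =>
      ih (by lia) N hN (e - k + 1) (by lia)
    -- The group for the residue field sits between Ext^{e-k}(L, X) and Ext^{e-k+1}(L/k, X), and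
    -- both vanish.
    have hmax : Subsingleton (Ext (ModuleCat.of R (R ⧸ maximalIdeal R)) X (e - k)) := by
      have hS := LinearMap.shortExact_moduleCatMk ι (LinearMap.range ι).mkQ hι
        (Submodule.mkQ_surjective _) (LinearMap.exact_map_mkQ_range ι)
      exact isExactClosed_subsingleton.contravariant_ext_X₁ hS X (hL _ (by lia))
        (ih' (L ⧸ LinearMap.range ι) inferInstance)
    -- Prime filtration: for a prime p ≠ 𝔪, an element of 𝔪 outside p is regular on R/p, and
    -- Nakayama applies.
    induction hN using IsNoetherianRing.induction_on_isQuotientEquivQuotientPrime R with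
    | subsingleton N =>
      have : IsZero (ModuleCat.of R N) := ModuleCat.isZero_of_subsingleton _
      refine subsingleton_of_forall_eq 0 fun x => ?_
      rw [← Ext.mk₀_id_comp x, this.eq_of_src (𝟙 _) 0, Ext.mk₀_zero, Ext.zero_comp]
    | quotient N p f =>
      refine subsingleton_ext_congr_left f X _ ?_
      rcases (IsLocalRing.le_maximalIdeal p.2.ne_top).eq_or_lt with h | h
      · rw [h]; exact hmax
      · obtain ⟨y, hy, hyp⟩ := SetLike.exists_of_lt h
        refine subsingleton_ext_of_isSMulRegular hy ?_ _ (hfin _ inferInstance _ (by lia))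
          (ih' _ inferInstance)
        rw [isSMulRegular_iff_right_eq_zero_of_smul]
        intro a ha
        obtain ⟨a, rfl⟩ := Ideal.Quotient.mk_surjective a
        rw [Algebra.smul_def, Ideal.Quotient.algebraMap_eq, ← map_mul,
          Ideal.Quotient.eq_zero_iff_mem] at ha
        exact Ideal.Quotient.eq_zero_iff_mem.mpr ((p.2.mem_or_mem ha).resolve_left hyp)
    | exact N₁ N₂ N₃ f g hf hg hfg h1 h3 =>
      exact isExactClosed_subsingleton.contravariant_ext_X₂
        (LinearMap.shortExact_moduleCatMk f g hf hg hfg) X h1 h3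

end Bass

/-! ### Maximal regular sequences -/

section RegularSequence

variable {R : Type u} [CommRing R] [IsLocalRing R]

open RingTheory.Sequence

theorem isRegular_append_singleton_iff (x : List R) (y : R) (hx : ∀ a ∈ x, a ∈ maximalIdeal R)
    (hy : y ∈ maximalIdeal R) :
    IsRegular R (x ++ [y]) ↔ IsWeaklyRegular R x ∧ IsSMulRegular (R ⧸ Ideal.ofList x) y := by
  have hmem : ∀ a ∈ x ++ [y], a ∈ maximalIdeal R := by
    intro a ha
    rcases List.mem_append.mp ha with h | h
    · exact hx a h
    · rwa [List.mem_singleton.mp h]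
  rw [IsLocalRing.isRegular_iff_isWeaklyRegular_of_subset_maximalIdeal hmem,
    isWeaklyRegular_append_iff, isWeaklyRegular_singleton_iff]
  have : (Ideal.ofList x • ⊤ : Submodule R R) = Ideal.ofList x := by
    rw [smul_eq_mul, Ideal.mul_top]
  rw [this]

variable [IsNoetherianRing R]

/-- The residue field embeds into `R/(x)` when `x` is a maximal `R`-sequence. -/
theorem IsMaximalRSequence.exists_injective {x : List R} (hx : IsMaximalRSequence x) :
    ∃ ι : (R ⧸ maximalIdeal R) →ₗ[R] (R ⧸ Ideal.ofList x), Function.Injective ι := by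
  obtain ⟨hmem, hreg, hmax⟩ := hx
  -- By maximality 𝔪 consists of zero divisors on R/(x), so prime avoidance places it inside one
  -- associated prime.
  obtain ⟨p, hp, hle⟩ := (Ideal.subset_union_prime_finite (f := id)
    (associatedPrimes.finite R (R ⧸ Ideal.ofList x)) ⊥ ⊥
    (fun I hI _ _ => IsAssociatedPrime.isPrime hI)).mp
    (show ((maximalIdeal R : Ideal R) : Set R) ⊆ _ by
      simp only [id]
      rw [biUnion_associatedPrimes_eq_compl_regular]
      exact fun y hy h => hmax y hy
        ((isRegular_append_singleton_iff x y hmem hy).mpr ⟨hreg.toIsWeaklyRegular, h⟩))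
  have hpm : p = maximalIdeal R :=
    ((IsLocalRing.le_maximalIdeal (IsAssociatedPrime.isPrime hp).ne_top).antisymm hle)
  exact ((isAssociatedPrime_iff_exists_injective_linearMap _ _).mp (hpm ▸ hp)).2

-- Choose a regular sequence whose ideal is maximal among such ideals. A prolongation by y would
-- leave the ideal unchanged, so y would act as zero on R/(x) ≠ 0 and could not be regular.
variable (R) in
theorem exists_isMaximalRSequence : ∃ x : List R, IsMaximalRSequence x := by
  obtain ⟨I, ⟨x, ⟨hmem, hreg⟩, rfl⟩, hI⟩ := set_has_maximal_iff_noetherian.mpr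
    (inferInstance : IsNoetherian R R)
    (Ideal.ofList '' {x : List R | (∀ a ∈ x, a ∈ maximalIdeal R) ∧ IsRegular R x})
    ⟨_, [], ⟨by simp, IsRegular.nil R R⟩, rfl⟩
  refine ⟨x, hmem, hreg, fun y hy hxy => ?_⟩
  have hmem' : ∀ a ∈ x ++ [y], a ∈ maximalIdeal R := by
    intro a ha
    rcases List.mem_append.mp ha with h | h
    · exact hmem a h
    · rwa [List.mem_singleton.mp h]
  have hle : Ideal.ofList x ≤ Ideal.ofList (x ++ [y]) := by
    rw [Ideal.ofList_append]; exact le_sup_left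
  have heq := hle.eq_of_not_lt (hI _ ⟨_, ⟨hmem', hxy⟩, rfl⟩)
  have hyx : y ∈ Ideal.ofList x := heq ▸ Ideal.subset_span (by simp)
  have h1 := ((isRegular_append_singleton_iff x y hmem hy).mp hxy).2
  rw [isSMulRegular_iff_right_eq_zero_of_smul] at h1
  have h2 : (Ideal.Quotient.mk (Ideal.ofList x)) 1 = 0 := h1 _ (by
    rw [Algebra.smul_def, Ideal.Quotient.algebraMap_eq, ← map_mul,
      Ideal.Quotient.eq_zero_iff_mem]
    simpa using hyx)
  rw [Ideal.Quotient.eq_zero_iff_mem] at h2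
  have h3 : Ideal.ofList x ≤ maximalIdeal R := Ideal.span_le.mpr hmem
  exact (Ideal.ne_top_iff_one _).mp (maximalIdeal.isMaximal R).ne_top (h3 h2)

theorem extVanishesEventually_quotient_of_isRegular (M : Type u) [AddCommGroup M] [Module R M]
    {x : List R} (hx : IsRegular R x) : ExtVanishesEventually R (R ⧸ Ideal.ofList x) M := by
  have h1 : projectiveDimension (ModuleCat.of R (R ⧸ Ideal.ofList x)) = x.length := by
    rw [← ModuleCat.projectiveDimension_quotient_eq_length.{u} x hx]
    exact projectiveDimension_eq_of_iso (Shrink.linearEquiv R _).symm.toModuleIso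
  have h2 : HasProjectiveDimensionLE (ModuleCat.of R (R ⧸ Ideal.ofList x)) x.length :=
    (projectiveDimension_le_iff _ _).mp h1.le
  exact ⟨x.length, fun i hi => HasProjectiveDimensionLT.subsingleton _ (x.length + 1) i hi _⟩

end RegularSequence

/-! ### Cycles and boundaries of a complex of injectives -/

section Cycles

open Abelian

variable {R : Type u} [CommRing R] (I : ChainComplex (ModuleCat.{u} R) ℤ)

theorem ChainComplex.shortExact_kernel_homologyπ (i : ℤ) :
    (ShortComplex.mk (kernel.ι (I.homologyπ i)) (I.homologyπ i)
      (kernel.condition _)).ShortExact where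
  exact := ShortComplex.exact_of_f_is_kernel _ (kernelIsKernel _)

theorem ChainComplex.iCycles_comp_toCycles {i j : ℤ} : I.iCycles i ≫ I.toCycles i j = 0 := by
  rw [← cancel_mono (I.iCycles j), Category.assoc, I.toCycles_i, I.iCycles_d, zero_comp]

theorem ChainComplex.exact_iCycles_toCycles {i j : ℤ} (hij : j + 1 = i) :
    (ShortComplex.mk (I.iCycles i) (I.toCycles i j) I.iCycles_comp_toCycles).Exact :=
  ShortComplex.exact_of_f_is_kernel _ <|
    KernelFork.IsLimit.ofι' _ _ fun {A} k hk =>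
      ⟨I.liftCycles k j (ComplexShape.next_eq' _ hij) (by
        rw [← I.toCycles_i, reassoc_of% hk, zero_comp]), I.liftCycles_i _ _ _ _⟩

theorem ChainComplex.exact_toCycles_homologyπ {i j : ℤ} (hij : j + 1 = i) :
    (ShortComplex.mk (I.toCycles i j) (I.homologyπ j) (I.toCycles_comp_homologyπ i j)).Exact :=
  ShortComplex.exact_of_g_is_cokernel _
    (I.homologyIsCokernel i j (ComplexShape.prev_eq' _ hij))

theorem ChainComplex.shortExact_toCycles {i j : ℤ} (hij : j + 1 = i)
    (h : IsZero (I.homology j)) :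
    (ShortComplex.mk (I.iCycles i) (I.toCycles i j) I.iCycles_comp_toCycles).ShortExact where
  exact := I.exact_iCycles_toCycles hij
  mono_f := inferInstanceAs (Mono (I.iCycles i))
  epi_g := (I.exact_toCycles_homologyπ hij).epi_f (h.eq_of_tgt _ _)

/-- The kernel of `homologyπ` serves as the module of boundaries, whether or not the homology
vanishes. -/
theorem ChainComplex.shortExact_kernelLift {i j : ℤ} (hij : j + 1 = i) :
    (ShortComplex.mk (I.iCycles i)
      (kernel.lift (I.homologyπ j) (I.toCycles i j) (I.toCycles_comp_homologyπ i j)) (by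
        rw [← cancel_mono (kernel.ι _), Category.assoc, kernel.lift_ι, zero_comp,
          I.iCycles_comp_toCycles])).ShortExact where
  exact := by
    have h := I.exact_iCycles_toCycles hij
    rw [ShortComplex.moduleCat_exact_iff] at h ⊢
    intro x hx
    refine h x ?_
    have hx' := (congrArg (kernel.ι (I.homologyπ j)) hx).trans (map_zero _)
    have hl := kernel.lift_ι (I.homologyπ j) (I.toCycles i j) (I.toCycles_comp_homologyπ i j)
    exact (congrArg (fun k => k.hom x) hl).symm.trans hx'
  mono_f := inferInstanceAs (Mono (I.iCycles i))
  epi_g := (ShortComplex.exact_iff_epi_kernel_lift _).mp (I.exact_toCycles_homologyπ hij)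

theorem IsZero.subsingleton_ext (N : ModuleCat.{u} R) {X : ModuleCat.{u} R} (hX : IsZero X)
    (j : ℕ) : Subsingleton (Ext N X j) :=
  have := hX.hasInjectiveDimensionLT_zero
  HasInjectiveDimensionLT.subsingleton X 0 j (Nat.zero_le j) N

theorem subsingleton_ext_of_injective (N X : ModuleCat.{u} R) [Injective X] {j : ℕ}
    (hj : 1 ≤ j) : Subsingleton (Ext N X j) :=
  HasInjectiveDimensionLT.subsingleton X 1 j hj N

variable {I}

namespace IsExactClosed

variable {P : ∀ (A : Type u) [AddCommGroup A] [Module R A], Prop} (hP : IsExactClosed P)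
  (hI : ∀ i, Injective (I.X i)) (N : ModuleCat.{u} R)

include hP hI

/-- The `Ext` modules of the boundaries of a complex of injectives are controlled by those
of the cycles one degree higher. -/
theorem ext_kernel_homologyπ {i i' : ℤ} (hi : i + 1 = i') {j : ℕ} (hj : 1 ≤ j)
    (h : P (Ext N (I.cycles i') (j + 1))) : P (Ext N (kernel (I.homologyπ i)) j) :=
  hP.ext_X₃ (I.shortExact_kernelLift hi) N
    (hP.of_subsingleton _ (have := hI i'; subsingleton_ext_of_injective N (I.X i') hj)) h

theorem ext_cycles (hb : ∃ a : ℤ, ∀ i, a < i → IsZero (I.X i)) (n : ℕ)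
    (hH : ∀ i, ∀ j, n < j → P (Ext N (I.homology i) j)) (i : ℤ) {j : ℕ} (hj : n < j) :
    P (Ext N (I.cycles i) j) := by
  obtain ⟨a, ha⟩ := hb
  -- Induction on the distance k below the top. Going down one step uses Ext degree j + 1, hence the
  -- quantification over all j > n.
  have H : ∀ k : ℕ, ∀ i : ℤ, a < i + k → ∀ j, n < j → P (Ext N (I.cycles i) j) := by
    intro k
    induction k with
    | zero =>
      intro i hi j _
      refine hP.of_subsingleton _ (IsZero.subsingleton_ext N ?_ j)
      exact IsZero.of_mono (I.iCycles i) (ha i (by simpa using hi))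
    | succ k ih =>
      intro i hi j hj
      exact hP.ext_X₂ (I.shortExact_kernel_homologyπ i) N
        (hP.ext_kernel_homologyπ hI N rfl (by lia) (ih (i + 1) (by push_cast at hi; lia)
          (j + 1) (by lia))) (hH i j hj)
  exact H (a + 1 - i).toNat i (by lia) j hj

end IsExactClosed

/-- If `I_c = 0` and `I` is exact in degrees `c < i < s`, then the cycles in degree `c + 1 + k`
have injective dimension at most `k`, for `c + 1 + k ≤ s`. -/
theorem hasInjectiveDimensionLT_cycles (hI : ∀ i, Injective (I.X i)) {c s : ℤ}
    (hc : IsZero (I.X c)) (hH : ∀ i < s, IsZero (I.homology i)) (k : ℕ) (hk : c + 1 + k ≤ s) :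
    HasInjectiveDimensionLT (I.cycles (c + 1 + k)) (k + 1) := by
  induction k with
  | zero =>
    have := hI (c + 1)
    have e : I.cycles (c + 1) ≅ I.X (c + 1) :=
      I.iCyclesIso (c + 1) c (ComplexShape.next_eq' _ rfl) (hc.eq_of_tgt _ _)
    simpa using hasInjectiveDimensionLT_of_iso e.symm 1
  | succ k ih =>
    have hS := I.shortExact_toCycles (i := c + 1 + (k + 1 : ℕ)) (j := c + 1 + k)
      (by push_cast; ring) (hH _ (by push_cast at hk; lia))
    have := hI (c + 1 + (k + 1 : ℕ))
    exact hS.hasInjectiveDimensionLT_X₁ (n := k + 1) (ih (by push_cast at hk; lia))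
      (hasInjectiveDimensionLT_of_ge _ 1 _ (by lia))

/-- Dimension shifting along the exact part of a complex of injectives. -/
theorem subsingleton_ext_cycles_sub (hI : ∀ i, Injective (I.X i)) (N : ModuleCat.{u} R) {s : ℤ}
    (hH : ∀ i < s, IsZero (I.homology i)) (k j : ℕ) (hj : 1 ≤ j)
    (h : Subsingleton (Ext N (I.cycles s) (j + k))) :
    Subsingleton (Ext N (I.cycles (s - k)) j) := by
  induction k generalizing j with
  | zero => simpa using h
  | succ k ih =>
    have := hI (s - k)
    exact isExactClosed_subsingleton.ext_X₃ (I.shortExact_toCycles (i := s - k)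
      (j := s - (k + 1 : ℕ)) (by push_cast; ring) (hH _ (by push_cast; lia))) N
      (subsingleton_ext_of_injective N _ hj)
      (ih (j + 1) (by lia) (by rwa [show j + 1 + k = j + (k + 1) by ring]))

end Cycles

/-! ### Canonical truncation -/

section Truncation

variable {R : Type u} [CommRing R]

open HomologicalComplex

/-- The embedding of `{i ≥ c}` into `ℤ`, for chain complexes. -/
def embeddingDownIntGE (c : ℤ) :
    ComplexShape.Embedding (ComplexShape.down ℕ) (ComplexShape.down ℤ) where
  f n := c + n
  injective_f _ _ h := by simpa using h
  rel {i j} h := by simp only [ComplexShape.down_Rel] at h ⊢; lia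

theorem embeddingDownIntGE_f (c : ℤ) (n : ℕ) : (embeddingDownIntGE c).f n = c + n := rfl

instance (c : ℤ) : (embeddingDownIntGE c).IsTruncLE where
  rel' i j h := by simp only [embeddingDownIntGE_f, ComplexShape.down_Rel] at h ⊢; lia
  mem_prev {i' j} h := ⟨j + 1, by
    simp only [embeddingDownIntGE_f, ComplexShape.down_Rel] at h ⊢
    push_cast; lia⟩

/-- If the homology of `I` vanishes below degree `c` and the cycles in degree `c` are injective,
then the canonical truncation of `I` in degrees `≥ c` is a complex of injectives with the same
homology. -/
theorem exists_truncation (I : ChainComplex (ModuleCat.{u} R) ℤ) (hI : ∀ i, Injective (I.X i))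
    (c : ℤ) (hH : ∀ i < c, IsZero (I.homology i)) (hZ : Injective (I.cycles c)) :
    ∃ K : ChainComplex (ModuleCat.{u} R) ℤ, (∀ i, Injective (K.X i)) ∧
      (∀ i < c, IsZero (K.X i)) ∧ (∀ i, c < i → Nonempty (K.X i ≅ I.X i)) ∧
      ∀ i, Nonempty (K.homology i ≅ I.homology i) := by
  have hlt : ∀ i < c, IsZero ((I.truncLE (embeddingDownIntGE c)).X i) := fun i hi =>
    (I.truncLE (embeddingDownIntGE c)).isZero_X_of_isStrictlySupported (embeddingDownIntGE c) i
      fun k hk => by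
        simp only [embeddingDownIntGE_f] at hk; lia
  have hgt : ∀ i, c < i → Nonempty ((I.truncLE (embeddingDownIntGE c)).X i ≅ I.X i) := by
    intro i hi
    obtain ⟨k, rfl⟩ : ∃ k : ℕ, i = c + (k + 1 : ℕ) := ⟨(i - c - 1).toNat, by push_cast; lia⟩
    exact ⟨I.truncLEXIso (embeddingDownIntGE c) (i := k + 1) rfl
      ((embeddingDownIntGE c).not_boundaryLE_prev (j := k) rfl)⟩
  have heq : Nonempty ((I.truncLE (embeddingDownIntGE c)).X c ≅ I.cycles c) :=
    ⟨I.truncLEXIsoCycles (embeddingDownIntGE c) (i := 0) (by simp [embeddingDownIntGE_f])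
      ((embeddingDownIntGE c).boundaryLE (k' := c - 1)
        (by simp [embeddingDownIntGE_f])
        fun i hi => by
          simp only [embeddingDownIntGE_f] at hi; lia)⟩
  refine ⟨I.truncLE (embeddingDownIntGE c), fun i => ?_, hlt, hgt, fun i => ?_⟩
  · rcases lt_trichotomy i c with h | rfl | h
    · exact (hlt i h).injective
    · exact Injective.of_iso heq.some.symm hZ
    · exact Injective.of_iso (hgt i h).some.symm (hI i)
  · rcases lt_or_ge i c with h | h
    · refine ⟨IsZero.iso ?_ (hH i h)⟩
      exact ShortComplex.isZero_homology_of_isZero_X₂ _ (hlt i h)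
    · obtain ⟨k, rfl⟩ : ∃ k : ℕ, i = c + k := ⟨(i - c).toNat, by lia⟩
      have : QuasiIsoAt (I.ιTruncLE (embeddingDownIntGE c)) (c + k) :=
        I.quasiIsoAt_ιTruncLE (embeddingDownIntGE c) (j := k) rfl
      exact ⟨isoOfQuasiIsoAt (I.ιTruncLE (embeddingDownIntGE c)) (c + k)⟩

end Truncation

/-! ### Quasi-injective resolutions and the equivalences -/

section Main

open Abelian

variable {R : Type u} [CommRing R] {M : Type u} [AddCommGroup M] [Module R M]

/-- A property closed under exact sequences passes from `Ext(N, M)` to `Ext(N, M^b)`. -/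
theorem IsExactClosed.ext_pi {P : ∀ (A : Type u) [AddCommGroup A] [Module R A], Prop}
    (hP : IsExactClosed P) (N : ModuleCat.{u} R) (j : ℕ)
    (h : P (Ext N (ModuleCat.of R M) j)) (b : ℕ) :
    P (Ext N (ModuleCat.of R (Fin b → M)) j) := by
  induction b with
  | zero =>
    exact hP.of_subsingleton _ (IsZero.subsingleton_ext N (ModuleCat.isZero_of_subsingleton _) j)
  | succ b ih =>
    let f : M →ₗ[R] (Fin (b + 1) → M) := LinearMap.single R (fun _ => M) 0
    let g : (Fin (b + 1) → M) →ₗ[R] (Fin b → M) := LinearMap.funLeft R M Fin.succ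
    refine hP.ext_X₂ (LinearMap.shortExact_moduleCatMk f g
      (Pi.single_injective (M := fun _ => M) 0) ?_ ?_) N h ih
    · exact fun y => ⟨Fin.cons (α := fun _ => M) 0 y, rfl⟩
    · intro y
      constructor
      · intro hy
        refine ⟨y 0, funext fun i => ?_⟩
        refine Fin.cases ?_ (fun i => ?_) i
        · simp [f]
        · have hi : y i.succ = 0 := congrFun hy i
          simp [f, hi]
      · rintro ⟨z, rfl⟩
        funext i
        simp [f, g, LinearMap.funLeft_apply]

theorem subsingleton_ext_of_retract {N X Y : ModuleCat.{u} R} (r : Retract X Y) (j : ℕ)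
    (h : Subsingleton (Ext N Y j)) : Subsingleton (Ext N X j) := by
  refine subsingleton_of_forall_eq 0 fun x => ?_
  have : x = (x.comp (Ext.mk₀ r.i) (add_zero j)).comp (Ext.mk₀ r.r) (add_zero j) := by
    rw [Ext.comp_assoc_of_third_deg_zero, Ext.mk₀_comp_mk₀, r.retract, Ext.comp_mk₀_id]
  rw [this, Subsingleton.elim (x.comp (Ext.mk₀ r.i) (add_zero j)) 0, Ext.zero_comp]

theorem IsExactClosed.ext_of_iso {P : ∀ (A : Type u) [AddCommGroup A] [Module R A], Prop}
    (hP : IsExactClosed P) (N : ModuleCat.{u} R) {X Y : ModuleCat.{u} R} (e : X ≅ Y) (j : ℕ)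
    (h : P (Ext N X j)) : P (Ext N Y j) :=
  -- Invariance under isomorphism is the exact-sequence axiom with zero as third term.
  hP.of_exact ((Ext.mk₀ e.hom).postcompOfLinear R N (add_zero j)) (0 : _ →ₗ[R] PUnit.{u + 1})
    (fun b _ => ⟨b.comp (Ext.mk₀ e.inv) (add_zero j), by
      simp⟩)
    h (hP.of_subsingleton _ inferInstance)

variable (M) in
/-- `M` is a retract of `M^b` for `b ≠ 0`. -/
noncomputable def retractPi {b : ℕ} (hb : b ≠ 0) :
    Retract (ModuleCat.of R M) (ModuleCat.of R (Fin b → M)) where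
  i := ModuleCat.ofHom (LinearMap.single R (fun _ => M) ⟨0, Nat.pos_of_ne_zero hb⟩)
  r := ModuleCat.ofHom (LinearMap.proj ⟨0, Nat.pos_of_ne_zero hb⟩)
  retract := by ext x; simp

namespace IsQuasiInjectiveResolution

variable {I : ChainComplex (ModuleCat.{u} R) ℤ} (hI : IsQuasiInjectiveResolution M I)

include hI

theorem ext_cycles {P : ∀ (A : Type u) [AddCommGroup A] [Module R A], Prop}
    (hP : IsExactClosed P) (N : ModuleCat.{u} R) (n : ℕ)
    (h : ∀ j, n < j → P (Ext N (ModuleCat.of R M) j)) (i : ℤ) {j : ℕ} (hj : n < j) :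
    P (Ext N (I.cycles i) j) := by
  obtain ⟨b, -, hb⟩ := hI.homology
  exact hP.ext_cycles hI.injective N hI.boundedAbove n
    (fun i j hj => hP.ext_of_iso N (hb i).some.symm j (hP.ext_pi N j (h j hj) _)) i hj

/-- If `Ext^i(N, M)` vanishes for `i ≫ 0`, then it vanishes for `i > n`, where `n` is the length
of the part of `I` below its lowest homology. -/
theorem extVanishesAbove (s : ℤ) (hs : IsHinf I s) (n : ℕ)
    (hn : ∀ i < s - n, IsZero (I.X i)) (N : Type u) [AddCommGroup N] [Module R N]
    (hN : ExtVanishesEventually R N M) : ExtVanishesAbove R N M n := by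
  obtain ⟨m, hm⟩ := hN
  induction m with
  | zero => exact fun i hi => hm i (by lia)
  | succ m ih =>
    -- For m < n the hypothesis already covers every degree above n; otherwise only degree m + 1 is
    -- missing.
    rcases Nat.lt_or_ge m n with hmn | hmn
    · exact fun i hi => hm i (by lia)
    refine ih fun i hi => ?_
    rcases (Nat.succ_le_of_lt hi).lt_or_eq with h | rfl
    · exact hm i h
    obtain ⟨b, -, hb⟩ := hI.homology
    have hbs : b s ≠ 0 := fun h0 => hs.1 <| by
      have : Subsingleton (Fin (b s) → M) := by rw [h0]; infer_instance
      exact (ModuleCat.isZero_of_subsingleton (ModuleCat.of R (Fin (b s) → M))).of_iso (hb s).some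
    have hcyc : HasInjectiveDimensionLT (I.cycles s) (m + 1) := by
      have := hasInjectiveDimensionLT_cycles hI.injective (c := s - (m + 1 : ℕ)) (s := s)
        (hn _ (by push_cast; lia))
        (fun i hi => by_contra fun h => absurd (hs.2 h) (by lia)) m (by push_cast; lia)
      rwa [show s - (m + 1 : ℕ) + 1 + m = s by push_cast; ring] at this
    have hB := isExactClosed_subsingleton.ext_kernel_homologyπ hI.injective (ModuleCat.of R N)
      (i := s) rfl (j := m + 1 + 1) (by lia)
      (hI.ext_cycles isExactClosed_subsingleton (ModuleCat.of R N) (m + 1) hm (s + 1) (by lia))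
    -- Ext^{m+1}(N, H_s) lies between Ext^{m+1}(N, Z_s) and Ext^{m+2}(N, B_s); `M` is a summand of
    -- H_s because b_s ≠ 0.
    have hH := isExactClosed_subsingleton.ext_X₃ (I.shortExact_kernel_homologyπ s)
      (ModuleCat.of R N) (n := m + 1)
      (HasInjectiveDimensionLT.subsingleton (I.cycles s) (m + 1) (m + 1) le_rfl _) hB
    exact subsingleton_ext_of_retract (retractPi M hbs) _
      (isExactClosed_subsingleton.ext_of_iso _ (hb s).some _ hH)

end IsQuasiInjectiveResolution

theorem IsBoundedQuasiInjectiveResolution.qid_le [Nontrivial M]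
    {I : ChainComplex (ModuleCat.{u} R) ℤ} (hI : IsBoundedQuasiInjectiveResolution M I) (s : ℤ)
    (hs : IsHinf I s) (n : ℕ) (hn : ∀ i < s - n, IsZero (I.X i)) :
    qid R M ≤ ((n : ℕ∞) : WithBot ℕ∞) := by
  have hsX : ¬ IsZero (I.X s) := fun h =>
    hs.1 (ShortComplex.isZero_homology_of_isZero_X₂ _ h)
  obtain ⟨t, ht, hmin⟩ := Int.exists_least_of_bdd (P := fun i => ¬ IsZero (I.X i))
    ⟨s - n, fun z hz => not_lt.mp fun h => hz (hn z h)⟩ ⟨s, hsX⟩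
  have h1 : s - n ≤ t := not_lt.mp fun h => ht (hn t h)
  have h2 : t ≤ s := hmin s hsX
  rw [qid, if_neg (not_subsingleton M)]
  have hle : (((s - t).toNat : ℕ∞) : WithBot ℕ∞) ≤ ((n : ℕ∞) : WithBot ℕ∞) := by
    exact_mod_cast (show (s - t).toNat ≤ n by lia)
  refine le_trans (sInf_le ?_) hle
  exact ⟨I, s, t, (s - t).toNat, hI, hs, ⟨ht, hmin⟩, by lia, rfl⟩

theorem exists_isBoundedQuasiInjectiveResolution_of_qid_lt [Nontrivial M] {q : WithBot ℕ∞}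
    (h : qid R M < q) : ∃ (I : ChainComplex (ModuleCat.{u} R) ℤ) (s : ℤ) (d : ℕ),
      IsBoundedQuasiInjectiveResolution M I ∧ IsHinf I s ∧ (∀ i < s - d, IsZero (I.X i)) ∧
      ((d : ℕ∞) : WithBot ℕ∞) < q := by
  rw [qid, if_neg (not_subsingleton M), sInf_lt_iff] at h
  obtain ⟨_, ⟨I, s, t, d, hI, hs, ht, hd, rfl⟩, hq⟩ := h
  exact ⟨I, s, d, hI, hs, fun i hi => by_contra fun h => absurd (ht.2 h) (by lia), hq⟩

theorem qid_le_of_extVanishesAbove [IsLocalRing R] [IsNoetherianRing R] [Nontrivial M]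
    (hExt : ExtFinite R M) (hqid : qid R M < ⊤) (n : ℕ) (x : List R) (hx : IsMaximalRSequence x)
    (hvan : ExtVanishesAbove R (R ⧸ Ideal.ofList x) M n) :
    qid R M ≤ ((n : ℕ∞) : WithBot ℕ∞) := by
  obtain ⟨I, s, d, hI, hs, hd, -⟩ := exists_isBoundedQuasiInjectiveResolution_of_qid_lt hqid
  rcases Nat.lt_or_ge n d with hnd | hnd
  swap
  · exact hI.qid_le s hs n fun i hi => hd i (by lia)
  have hH : ∀ i < s, IsZero (I.homology i) := fun i hi =>
    by_contra fun h => absurd (hs.2 h) (by lia)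
  -- Since I vanishes in degree s - d - 1, the exact part below s resolves Z_{s-n} with length d -
  -- n.
  have hid : HasInjectiveDimensionLT (I.cycles (s - n)) (d - n + 1) := by
    have := hasInjectiveDimensionLT_cycles hI.injective (c := s - d - 1) (s := s)
      (hd _ (by lia)) hH (d - n) (by lia)
    rwa [show s - d - 1 + 1 + (d - n : ℕ) = s - n by lia] at this
  obtain ⟨ι, hι⟩ := hx.exists_injective
  have hZ : Injective (I.cycles (s - n)) :=
    ModuleCat.injective_of_subsingleton_ext (I.cycles (s - n)) (d - n + 1)
      -- `Ext`-finiteness of `M` passes to the cycles in all degrees j ≥ 1, hence the bound 0.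
      (fun N _ _ hN j hj => hI.ext_cycles isExactClosed_finite (ModuleCat.of R N) 0
        (fun j hj => hExt N hN j hj) (s - n) hj)
      (R ⧸ Ideal.ofList x)
      (fun j hj => subsingleton_ext_cycles_sub hI.injective _ hH n j hj
        (hI.ext_cycles isExactClosed_subsingleton _ n hvan s (by lia))) ι hι
  obtain ⟨K, hKinj, hKlt, hKgt, hKH⟩ := exists_truncation I hI.injective (s - n)
    (fun i hi => hH i (by lia)) hZ
  have hK : IsBoundedQuasiInjectiveResolution M K := by
    obtain ⟨b, hb0, hb⟩ := hI.homology
    obtain ⟨a, ha⟩ := hI.boundedAbove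
    exact
      { injective := hKinj
        boundedAbove := ⟨max a (s - n), fun i hi =>
          (ha i (lt_of_le_of_lt (le_max_left _ _) hi)).of_iso
            (hKgt i (lt_of_le_of_lt (le_max_right _ _) hi)).some⟩
        homology := ⟨b, hb0, fun i => ⟨(hKH i).some ≪≫ (hb i).some⟩⟩
        boundedBelow := ⟨s - n, hKlt⟩ }
  refine hK.qid_le s ?_ n hKlt
  exact ⟨fun h => hs.1 (h.of_iso (hKH s).some.symm),
    fun i hi => hs.2 fun h => hi (h.of_iso (hKH i).some)⟩

end Main
theorem theorem3p1 {R : Type u} [CommRing R] [IsLocalRing R] [IsNoetherianRing R]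
    (M : Type u) [AddCommGroup M] [Module R M] [Nontrivial M]
    (hExt : ExtFinite R M) (hqid : qid R M < ⊤) (n : ℕ) :
    List.TFAE [
      qid R M ≤ ((n : ℕ∞) : WithBot ℕ∞),
      ∀ (N : Type u) [AddCommGroup N] [Module R N],
        ExtVanishesEventually R N M → ExtVanishesAbove R N M n,
      ∀ J : Ideal R,
        ExtVanishesEventually R (R ⧸ J) M → ExtVanishesAbove R (R ⧸ J) M n,
      ∀ x : List R, IsMaximalRSequence x → ExtVanishesAbove R (R ⧸ Ideal.ofList x) M n,
      ∃ x : List R, IsMaximalRSequence x ∧ ExtVanishesAbove R (R ⧸ Ideal.ofList x) M n] := by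
  tfae_have 1 → 2 := by
    intro h N _ _ hN
    -- The strict bound n + 1 produces an actual resolution, whose length d below s is then at most
    -- n.
    have hlt : qid R M < ((n + 1 : ℕ) : ℕ∞) :=
      h.trans_lt (by exact_mod_cast Nat.lt_succ_self n)
    obtain ⟨I, s, d, hI, hs, hd, hdn⟩ := exists_isBoundedQuasiInjectiveResolution_of_qid_lt hlt
    have hdn' : d < n + 1 := by exact_mod_cast hdn
    exact hI.extVanishesAbove s hs n (fun i hi => hd i (by lia)) N hN
  tfae_have 2 → 3 := fun h J => h (R ⧸ J)
  tfae_have 3 → 4 := fun h x hx =>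
    h _ (extVanishesEventually_quotient_of_isRegular M hx.2.1)
  tfae_have 4 → 5 := fun h => by
    obtain ⟨x, hx⟩ := exists_isMaximalRSequence R
    exact ⟨x, hx, h x hx⟩
  tfae_have 5 → 1 := fun ⟨x, hx, h⟩ => qid_le_of_extVanishesAbove hExt hqid n x hx h
  tfae_finish
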